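/- Let $\mathscr H$ be a complex Hilbert space. For a contraction $T$ on $\mathscr H$ (a linear operator with $\|T\|\le 1$), let $D_T=(I-T^*T)^{1/2}$ and $D_{T^*}=(I-TT^*)^{1/2}$ be its defect operators. For $0<p<\infty$ let $\boldsymbol S_p$ be the Schatten--von Neumann class of bounded operators $A$ on $\mathscr H$ with $\sum_{n\ge0}s_n(A)^p<\infty$, where $s_n(A)=\inf\{\|A-R\|:\operatorname{rank}R\le n\}$ are the singular values of $A$. For a positive bounded operator $D$ with $\operatorname{Ker}D=\{0\}$ and $s>0$, $D^{-s}$ denotes the (in general unbounded) inverse of $D^{s}$, with domain $\operatorname{Ran}D^{s}$; for a bounded operator $B$ we write $BD^{-s}\in\boldsymbol S_p$ if $BD^{-s}$ extends from this dense domain to an operator on $\mathscr H$ of class $\boldsymbol S_p$. **Lemma 2.1.** Let $0<p<\infty$. Suppose that $T_0$ and $T_1$ are contractions on $\mathscr H$ such that $\operatorname{Ker}D_{T_0}=\{0\}$ (equivalently, $\operatorname{Ker}D_{T_0^*}=\{0\}$) and $$(T_1-T_0)D_{T_0}^{-2\alpha}\in\boldsymbol S_p\quad\text{and}\quad (T_1^*-T_0^*)D_{T_0^*}^{-2\alpha}\in\boldsymbol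 S_p$$ for some $\alpha\in(\tfrac12,1]$. Then $$D_{T_1}-D_{T_0}\in\boldsymbol S_p\quad\text{and}\quad D_{T_1^*}-D_{T_0^*}\in\boldsymbol S_p.$$ -/

import Mathlib

namespace HilbertOp

variable {H : Type*} [NormedAddCommGroup H] [InnerProductSpace ℂ H] [CompleteSpace H]

/-- The `n`-th singular value (`n = 0, 1, 2, …`) of a bounded operator: its distance, in the
operator norm, to the set of operators of rank at most `n`. -/
noncomputable def singularValue (T : H →L[ℂ] H) (n : ℕ) : ℝ :=
  Metric.infDist T {R : H →L[ℂ] H | LinearMap.rank (R : H →ₗ[ℂ] H) ≤ (n : Cardinal)}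

/-- Membership of a bounded operator in the Schatten--von Neumann class `S_p`, `0 < p < ∞`:
`∑ sₙ(T) ^ p < ∞`. (Then `sₙ(T) → 0`, so that `T` is compact.) -/
def MemSchatten (p : ℝ) (T : H →L[ℂ] H) : Prop :=
  Summable fun n : ℕ => singularValue T n ^ p

/-- The defect operator `D_T = (I - T* T)^{1/2}` of a contraction `T`; the other
defect operator `D_{T*} = (I - T T*)^{1/2}` is `defect (adjoint T)`. -/
noncomputable def defect (T : H →L[ℂ] H) : H →L[ℂ] H :=
  CFC.sqrt (1 - ContinuousLinearMap.adjoint T * T)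

/-- For a positive bounded operator `D` with `Ker D = {0}` and `s > 0`, the negative power
`D^{-s} = (D^s)^{-1}`, a (generally unbounded) operator with domain `Ran D^s`. -/
noncomputable def negPow (D : H →L[ℂ] H) (s : ℝ) : H →ₗ.[ℂ] H :=
  (LinearMap.toPMap ((D ^ s : H →L[ℂ] H) : H →ₗ[ℂ] H) ⊤).inverse

/-- A densely defined operator `A` is in `S_p` if it extends to a bounded operator on the whole
space that belongs to `S_p`. -/
def PMapMemSchatten (p : ℝ) (A : H →ₗ.[ℂ] H) : Prop :=
  ∃ K : H →L[ℂ] H, A ≤ LinearMap.toPMap (K : H →ₗ[ℂ] H) ⊤ ∧ MemSchatten p K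

end HilbertOp

/-!
Write `D₀`, `D₁` for the defect operators of `T₀`, `T₁` and `β = 2 α ∈ (1, 2]`. The hypotheses say
that `T₁ - T₀ = K D₀ ^ β` and `T₁* - T₀* = K' D_{T₀*} ^ β` with `K`, `K'` in `S_p`. Since
`T₀ D₀ = D_{T₀*} T₀`, and hence `T₀ D₀ ^ β = D_{T₀*} ^ β T₀`, the difference
`D₁² - D₀² = T₀* T₀ - T₁* T₁` equals `M D₀ ^ β` with `M = -(T₁* K + K' T₀)` in `S_p`. As
`D₁² - D₀² = D₁ X + X D₀` for `X = D₁ - D₀`, it remains to see that the solution `X` of the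
Sylvester equation `D₁ X + X D₀ = M D₀ ^ β` is in `S_p` (`memSchatten_of_sylvester`).

Formally `X` is obtained from `M` by the double operator integral with symbol `μ ^ β / (λ + μ)`. A
dyadic partition of unity in `μ` localizes this symbol to `μ ≈ c = 2 * 2⁻ᵏ`, where `1 / (λ + μ)` is
expanded in a geometric series about `1 / (λ + c)`. The result is a series `X = ∑ A_{kj} M B_{kj}`,
with `A_{kj}` a function of `D₁`, `B_{kj}` a function of `D₀`, and
`‖A_{kj}‖ ‖B_{kj}‖ ≤ c ^ (β - 1) (3 / 4) ^ j`. These weights decay geometrically in both `k` and `j`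
because `β > 1`.

Such a series is in `S_p` for every `0 < p < ∞` (`memSchatten_of_hasSum`): approximate the term of
weight `w` by an operator of rank `⌊n / N⌋`, where `N` is comparable to a small negative power of
`w` and the `1 / N` add up to at most `1`. This gives `sₙ(X) ≤ ∑ w s_{⌊n / N⌋}(M)`, and the `p`-th
powers of the right side are summable over `n`. The second assertion is the first one for the
adjoints.
-/

open HilbertOp

/-! ### Singular values -/

section SingularValues

variable {H : Type*} [NormedAddCommGroup H] [InnerProductSpace ℂ H]

lemma zero_mem_setOf_rank_le (n : ℕ) :
    (0 : H →L[ℂ] H) ∈ {R : H →L[ℂ] H | LinearMap.rank (R : H →ₗ[ℂ] H) ≤ (n : Cardinal)} := by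
  simp

lemma singularValue_nonneg (T : H →L[ℂ] H) (n : ℕ) : 0 ≤ singularValue T n :=
  Metric.infDist_nonneg

lemma singularValue_le_norm_sub {T R : H →L[ℂ] H} {n : ℕ}
    (hR : LinearMap.rank (R : H →ₗ[ℂ] H) ≤ (n : Cardinal)) : singularValue T n ≤ ‖T - R‖ := by
  rw [← dist_eq_norm]
  exact Metric.infDist_le_dist_of_mem hR

lemma exists_rank_le_norm_sub_lt {T : H →L[ℂ] H} {n : ℕ} {r : ℝ} (hr : singularValue T n < r) :
    ∃ R : H →L[ℂ] H, LinearMap.rank (R : H →ₗ[ℂ] H) ≤ (n : Cardinal) ∧ ‖T - R‖ < r := by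
  obtain ⟨R, hR, hd⟩ := (Metric.infDist_lt_iff ⟨0, zero_mem_setOf_rank_le n⟩).1 hr
  exact ⟨R, hR, by rwa [← dist_eq_norm]⟩

lemma singularValue_mul_mul_le (A T B : H →L[ℂ] H) (n : ℕ) :
    singularValue (A * T * B) n ≤ ‖A‖ * ‖B‖ * singularValue T n := by
  have key : ∀ ε > 0, singularValue (A * T * B) n ≤ ‖A‖ * ‖B‖ * (singularValue T n + ε) := by
    intro ε hε
    obtain ⟨R, hR, hd⟩ := exists_rank_le_norm_sub_lt (lt_add_of_pos_right (singularValue T n) hε)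
    have hrank : LinearMap.rank ((A * R * B : H →L[ℂ] H) : H →ₗ[ℂ] H) ≤ (n : Cardinal) :=
      calc LinearMap.rank ((A * R * B : H →L[ℂ] H) : H →ₗ[ℂ] H)
          ≤ LinearMap.rank ((A * R : H →L[ℂ] H) : H →ₗ[ℂ] H) :=
            LinearMap.rank_comp_le_left (B : H →ₗ[ℂ] H) ((A * R : H →L[ℂ] H) : H →ₗ[ℂ] H)
        _ ≤ LinearMap.rank (R : H →ₗ[ℂ] H) :=
            LinearMap.rank_comp_le_right (R : H →ₗ[ℂ] H) (A : H →ₗ[ℂ] H)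
        _ ≤ n := hR
    calc singularValue (A * T * B) n ≤ ‖A * T * B - A * R * B‖ := singularValue_le_norm_sub hrank
      _ = ‖A * (T - R) * B‖ := by rw [mul_sub, sub_mul]
      _ ≤ ‖A‖ * ‖T - R‖ * ‖B‖ :=
        (norm_mul_le _ _).trans (mul_le_mul_of_nonneg_right (norm_mul_le _ _) (norm_nonneg _))
      _ = ‖A‖ * ‖B‖ * ‖T - R‖ := by ring
      _ ≤ ‖A‖ * ‖B‖ * (singularValue T n + ε) := by gcongr
  have hlim : Filter.Tendsto (fun ε : ℝ => ‖A‖ * ‖B‖ * (singularValue T n + ε))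
      (nhdsWithin 0 (Set.Ioi 0)) (nhds (‖A‖ * ‖B‖ * (singularValue T n + 0))) :=
    (Continuous.tendsto (by fun_prop) 0).mono_left nhdsWithin_le_nhds
  rw [add_zero] at hlim
  exact ge_of_tendsto hlim (eventually_nhdsWithin_of_forall key)

/-- If `∑ Nᵢ⁻¹ ≤ 1`, rank `n` can be shared out among the terms of a series, the `i`-th term being
granted rank `⌊n / Nᵢ⌋`. -/
lemma singularValue_le_tsum_div {ι : Type*} {w : ι → ℝ} {s : ℕ → ℝ} {N : ι → ℕ}
    (hw : ∀ i, 0 < w i) (hws : Summable w) (hN : ∀ F : Finset ι, ∑ i ∈ F, (N i : ℝ)⁻¹ ≤ 1)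
    (hNfin : ∀ n : ℕ, {i | N i ≤ n}.Finite)
    {Y : ι → H →L[ℂ] H} (hY : ∀ i n, singularValue (Y i) n ≤ w i * s n)
    {X : H →L[ℂ] H} (hX : HasSum Y X) (n : ℕ) (hs : Summable fun i => w i * s (n / N i)) :
    singularValue X n ≤ ∑' i, w i * s (n / N i) := by
  refine le_of_forall_pos_le_add fun ε hε => ?_
  set W := ∑' i, w i
  have hW0 : 0 ≤ W := tsum_nonneg fun i => (hw i).le
  set η := ε / (W + 1) with hη
  have hη0 : 0 < η := by positivity
  have hex : ∀ i, ∃ R : H →L[ℂ] H, LinearMap.rank (R : H →ₗ[ℂ] H) ≤ ((n / N i : ℕ) : Cardinal) ∧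
      ‖Y i - R‖ < w i * s (n / N i) + w i * η := fun i =>
    exists_rank_le_norm_sub_lt
      ((hY i _).trans_lt (lt_add_of_pos_right _ (mul_pos (hw i) hη0)))
  choose R hR hRd using hex
  set F := (hNfin n).toFinset with hF
  -- Only finitely many terms receive a positive rank; all the others are approximated by `0`.
  have hR0 : ∀ i ∉ F, R i = 0 := by
    intro i hi
    have h1 : n / N i = 0 := Nat.div_eq_of_lt (by simpa [hF] using hi)
    have h2 := hR i
    rw [h1, Nat.cast_zero, nonpos_iff_eq_zero, LinearMap.rank, Submodule.rank_eq_zero,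
      LinearMap.range_eq_bot] at h2
    exact ContinuousLinearMap.coe_injective h2
  have hrank : LinearMap.rank ((∑ i ∈ F, R i : H →L[ℂ] H) : H →ₗ[ℂ] H) ≤ (n : Cardinal) := by
    rw [ContinuousLinearMap.toLinearMap_sum]
    refine (LinearMap.rank_finsetSum_le _ _).trans ((Finset.sum_le_sum fun i _ => hR i).trans ?_)
    rw [← Nat.cast_sum, Nat.cast_le]
    have h1 : ((∑ i ∈ F, n / N i : ℕ) : ℝ) ≤ n := by
      rw [Nat.cast_sum]
      calc ∑ i ∈ F, ((n / N i : ℕ) : ℝ) ≤ ∑ i ∈ F, (n : ℝ) * (N i : ℝ)⁻¹ :=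
            Finset.sum_le_sum fun i _ => Nat.cast_div_le.trans (div_eq_mul_inv _ _).le
        _ = n * ∑ i ∈ F, (N i : ℝ)⁻¹ := by rw [Finset.mul_sum]
        _ ≤ n * 1 := by gcongr; exact hN F
        _ = n := mul_one _
    exact_mod_cast h1
  have hsum : HasSum (fun i => Y i - R i) (X - ∑ i ∈ F, R i) :=
    hX.sub (hasSum_sum_of_ne_finset_zero hR0)
  have hbound : HasSum (fun i => w i * s (n / N i) + w i * η)
      ((∑' i, w i * s (n / N i)) + W * η) := hs.hasSum.add (hws.hasSum.mul_right η)
  calc singularValue X n ≤ ‖X - ∑ i ∈ F, R i‖ := singularValue_le_norm_sub hrank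
    _ ≤ (∑' i, w i * s (n / N i)) + W * η := hsum.norm_le_of_bounded hbound fun i => (hRd i).le
    _ ≤ (∑' i, w i * s (n / N i)) + ε := by
      gcongr
      rw [hη, mul_div_assoc', div_le_iff₀ (by positivity)]
      nlinarith

end SingularValues

/-! ### Series of operators with rapidly decreasing singular values -/

lemma hasSum_comp_div {f : ℕ → ℝ} (hf : Summable f) {N : ℕ} (hN : N ≠ 0) :
    HasSum (fun n => f (n / N)) (N * ∑' m, f m) := by
  have : NeZero N := ⟨hN⟩
  rw [← (Nat.divModEquiv N).symm.hasSum_iff]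
  have h1 : HasSum (fun x : Fin N × ℕ => f x.2) (N * ∑' m, f m) := by
    have h2 : Summable (fun x : Fin N × ℕ => (1 : ℝ) * f x.2) :=
      summable_mul_of_summable_norm (f := fun _ : Fin N => (1 : ℝ)) (g := f)
        (Summable.of_finite) hf.norm
    simp only [one_mul] at h2
    convert h2.hasSum using 1
    rw [h2.tsum_prod]
    simp
  rw [← (Equiv.prodComm ℕ (Fin N)).hasSum_iff] at h1
  convert h1 using 1
  ext ⟨m, j⟩
  have : (m * N + (j : ℕ)) / N = m := by
    rw [mul_comm, Nat.mul_add_div (Nat.pos_of_ne_zero hN), Nat.div_eq_of_lt j.2, add_zero]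
  simp [Nat.divModEquiv, this]

/-- A weighted sum raised to the power `p` is controlled by the sum of the `p`-th powers, at the
cost of half of the weight. This replaces both the triangle inequality (`p ≥ 1`) and the
subadditivity of `x ↦ x ^ p` (`p ≤ 1`). -/
lemma tsum_mul_rpow_le {ι : Type*} {p : ℝ} (hp : 0 < p) {w t : ι → ℝ} (hw : ∀ i, 0 < w i)
    (ht : ∀ i, 0 ≤ t i) (hws : Summable fun i => w i ^ (1 / 2 : ℝ))
    (h : Summable fun i => w i ^ (p / 2) * t i ^ p) :
    (∑' i, w i * t i) ^ p ≤
      (∑' i, w i ^ (1 / 2 : ℝ)) ^ p * ∑' i, w i ^ (p / 2) * t i ^ p := by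
  set b := ∑' i, w i ^ (p / 2) * t i ^ p
  have hnn : ∀ i, 0 ≤ w i ^ (p / 2) * t i ^ p := fun i =>
    mul_nonneg (Real.rpow_nonneg (hw i).le _) (Real.rpow_nonneg (ht i) _)
  have hb0 : 0 ≤ b := tsum_nonneg hnn
  have hle : ∀ i, w i ^ (1 / 2 : ℝ) * t i ≤ b ^ (1 / p) := by
    intro i
    have h1 : (w i ^ (1 / 2 : ℝ) * t i) ^ p ≤ b := by
      rw [Real.mul_rpow (Real.rpow_nonneg (hw i).le _) (ht i), ← Real.rpow_mul (hw i).le,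
        one_div_mul_eq_div]
      exact h.le_tsum i fun j _ => hnn j
    calc w i ^ (1 / 2 : ℝ) * t i = ((w i ^ (1 / 2 : ℝ) * t i) ^ p) ^ (1 / p) := by
          rw [← Real.rpow_mul (mul_nonneg (Real.rpow_nonneg (hw i).le _) (ht i)),
            mul_one_div_cancel hp.ne', Real.rpow_one]
      _ ≤ b ^ (1 / p) := Real.rpow_le_rpow
          (Real.rpow_nonneg (mul_nonneg (Real.rpow_nonneg (hw i).le _) (ht i)) _) h1 (by positivity)
  have hterm : ∀ i, w i * t i ≤ w i ^ (1 / 2 : ℝ) * b ^ (1 / p) := by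
    intro i
    calc w i * t i = w i ^ (1 / 2 : ℝ) * (w i ^ (1 / 2 : ℝ) * t i) := by
          rw [← mul_assoc, ← Real.rpow_add (hw i)]; norm_num
      _ ≤ _ := mul_le_mul_of_nonneg_left (hle i) (Real.rpow_nonneg (hw i).le _)
  have hnn' : ∀ i, 0 ≤ w i * t i := fun i => mul_nonneg (hw i).le (ht i)
  have hsum : Summable fun i => w i * t i := (hws.mul_right _).of_nonneg_of_le hnn' hterm
  calc (∑' i, w i * t i) ^ p ≤ ((∑' i, w i ^ (1 / 2 : ℝ)) * b ^ (1 / p)) ^ p := by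
        refine Real.rpow_le_rpow (tsum_nonneg hnn') ?_ hp.le
        rw [← tsum_mul_right]
        exact hsum.tsum_le_tsum hterm (hws.mul_right _)
    _ = (∑' i, w i ^ (1 / 2 : ℝ)) ^ p * b := by
        rw [Real.mul_rpow (tsum_nonneg fun i => Real.rpow_nonneg (hw i).le _)
          (Real.rpow_nonneg hb0 _), ← Real.rpow_mul hb0, one_div_mul_cancel hp.ne', Real.rpow_one]

section Series

variable {H : Type*} [NormedAddCommGroup H] [InnerProductSpace ℂ H]

/-- A norm convergent series of operators whose singular values are dominated by `wᵢ sₙ`, with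
`(sₙ)` in `ℓᵖ` and weights summable to every positive power, has its sum in `S_p`. The ranks are
shared out in proportion to `wᵢ ^ (p / 4)`. No triangle inequality in `S_p` is involved, so that all
`0 < p < ∞` are treated alike. -/
theorem memSchatten_of_hasSum {ι : Type*} {p : ℝ} (hp : 0 < p) {s : ℕ → ℝ} (hs0 : ∀ n, 0 ≤ s n)
    (hs : Summable fun n => s n ^ p) {w : ι → ℝ} (hw : ∀ i, 0 < w i)
    (hws : ∀ δ : ℝ, 0 < δ → Summable fun i => w i ^ δ) {Y : ι → H →L[ℂ] H}
    (hY : ∀ i n, singularValue (Y i) n ≤ w i * s n) {X : H →L[ℂ] H} (hX : HasSum Y X) :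
    MemSchatten p X := by
  have hwd : ∀ (δ : ℝ) i, 0 < w i ^ δ := fun δ i => Real.rpow_pos_of_pos (hw i) δ
  have hsd : ∀ n, 0 ≤ s n ^ p := fun n => Real.rpow_nonneg (hs0 n) p
  set δ := p / 4 with hδ
  have hδ0 : 0 < δ := by positivity
  set V := ∑' i, w i ^ δ
  have hV0 : 0 ≤ V := tsum_nonneg fun i => (hwd δ i).le
  set N : ι → ℕ := fun i => ⌈(V + 1) / w i ^ δ⌉₊
  have hNge : ∀ i, (V + 1) / w i ^ δ ≤ N i := fun i => Nat.le_ceil _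
  have hNpos : ∀ i, (0 : ℝ) < N i := fun i => (div_pos (by positivity) (hwd δ i)).trans_le (hNge i)
  have hNle : ∀ i, (N i : ℝ) ≤ 2 * (V + 1) / w i ^ δ := by
    intro i
    have h1 : w i ^ δ ≤ V := (hws δ hδ0).le_tsum i fun j _ => (hwd δ j).le
    have h2 : 1 ≤ (V + 1) / w i ^ δ := (one_le_div (hwd δ i)).2 (by linarith)
    have h3 := (Nat.ceil_lt_add_one (div_pos (by positivity : 0 < V + 1) (hwd δ i)).le).le
    calc (N i : ℝ) ≤ (V + 1) / w i ^ δ + 1 := h3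
      _ ≤ (V + 1) / w i ^ δ + (V + 1) / w i ^ δ := by gcongr
      _ = 2 * (V + 1) / w i ^ δ := by ring
  have hNinv : ∀ i, (N i : ℝ)⁻¹ ≤ w i ^ δ / (V + 1) := by
    intro i
    rw [← inv_div]
    exact inv_anti₀ (div_pos (by positivity) (hwd δ i)) (hNge i)
  have hN : ∀ F : Finset ι, ∑ i ∈ F, (N i : ℝ)⁻¹ ≤ 1 := by
    intro F
    calc ∑ i ∈ F, (N i : ℝ)⁻¹ ≤ ∑ i ∈ F, w i ^ δ / (V + 1) := Finset.sum_le_sum fun i _ => hNinv i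
      _ = (∑ i ∈ F, w i ^ δ) / (V + 1) := by rw [Finset.sum_div]
      _ ≤ 1 := by
        rw [div_le_one (by positivity)]
        exact ((hws δ hδ0).sum_le_tsum F fun i _ => (hwd δ i).le).trans (by linarith)
  have hNfin : ∀ n : ℕ, {i | N i ≤ n}.Finite := by
    intro n
    have h1 := (hws δ hδ0).tendsto_cofinite_zero.eventually
      (gt_mem_nhds (show (0 : ℝ) < (V + 1) / (n + 1) by positivity))
    rw [Filter.eventually_cofinite] at h1
    refine h1.subset fun i (hi : N i ≤ n) => ?_
    have h2 : (V + 1) / w i ^ δ ≤ n + 1 := (hNge i).trans (by exact_mod_cast hi.trans n.le_succ)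
    rw [div_le_iff₀ (hwd δ i)] at h2
    rw [Set.mem_ofPred_eq, not_lt, div_le_iff₀ (by positivity)]
    linarith
  -- The double series over `i` and `n` converges, because `s` is sampled at `n / Nᵢ`.
  set S := ∑' m, s m ^ p
  have hcol : ∀ i, HasSum (fun n => w i ^ (p / 2) * s (n / N i) ^ p)
      (w i ^ (p / 2) * (N i * S)) := fun i =>
    (hasSum_comp_div hs (by exact_mod_cast (hNpos i).ne')).mul_left _
  have hdouble : Summable fun x : ι × ℕ => w x.1 ^ (p / 2) * s (x.2 / N x.1) ^ p := by
    rw [summable_prod_of_nonneg fun x => mul_nonneg (hwd _ _).le (hsd _)]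
    refine ⟨fun i => (hcol i).summable, ?_⟩
    simp_rw [fun i => (hcol i).tsum_eq]
    refine Summable.of_nonneg_of_le (fun i => ?_) (fun i => ?_)
      ((hws δ hδ0).mul_right (2 * (V + 1) * S))
    · exact mul_nonneg (hwd _ _).le (mul_nonneg (hNpos i).le (tsum_nonneg hsd))
    · have hS0 : 0 ≤ S := tsum_nonneg hsd
      have h1 : w i ^ (p / 2) = w i ^ δ * w i ^ δ := by
        rw [← Real.rpow_add (hw i), hδ]; ring_nf
      calc w i ^ (p / 2) * (N i * S) ≤ w i ^ (p / 2) * (2 * (V + 1) / w i ^ δ * S) := by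
            gcongr
            · exact (hwd _ _).le
            · exact hNle i
        _ = w i ^ δ * (2 * (V + 1) * S) := by
            rw [h1]; field_simp [(hwd δ i).ne']
  have hswap : Summable fun x : ℕ × ι => w x.2 ^ (p / 2) * s (x.1 / N x.2) ^ p := hdouble.prod_symm
  have hrow := hswap.prod
  have hrow' : ∀ n, Summable fun i => w i ^ (p / 2) * s (n / N i) ^ p := hswap.prod_factor
  have hw1 : Summable w := by simpa using hws 1 one_pos
  obtain ⟨B, hB⟩ : ∃ B, ∀ n, s n ≤ B := by
    refine ⟨S ^ (1 / p), fun n => ?_⟩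
    calc s n = (s n ^ p) ^ (1 / p) := by
          rw [← Real.rpow_mul (hs0 n), mul_one_div_cancel hp.ne', Real.rpow_one]
      _ ≤ S ^ (1 / p) :=
          Real.rpow_le_rpow (hsd n) (hs.le_tsum n fun j _ => hsd j) (by positivity)
  have hsn : ∀ n, Summable fun i => w i * s (n / N i) := fun n =>
    (hw1.mul_right B).of_nonneg_of_le (fun i => mul_nonneg (hw i).le (hs0 _))
      fun i => mul_le_mul_of_nonneg_left (hB _) (hw i).le
  refine Summable.of_nonneg_of_le (fun n => Real.rpow_nonneg (singularValue_nonneg X n) p)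
    (fun n => ?_) (hrow.mul_left ((∑' i, w i ^ (1 / 2 : ℝ)) ^ p))
  calc singularValue X n ^ p ≤ (∑' i, w i * s (n / N i)) ^ p :=
        Real.rpow_le_rpow (singularValue_nonneg X n)
          (singularValue_le_tsum_div hw hw1 hN hNfin hY hX n (hsn n)) hp.le
    _ ≤ _ := tsum_mul_rpow_le hp hw (fun i => hs0 _) (hws _ (by norm_num)) (hrow' n)

lemma HilbertOp.MemSchatten.mul_mul {p : ℝ} (hp : 0 < p) {T : H →L[ℂ] H} (hT : MemSchatten p T)
    (A B : H →L[ℂ] H) : MemSchatten p (A * T * B) := by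
  refine Summable.of_nonneg_of_le (fun n => Real.rpow_nonneg (singularValue_nonneg _ n) p)
    (fun n => ?_) (hT.mul_left ((‖A‖ * ‖B‖) ^ p))
  rw [← Real.mul_rpow (by positivity) (singularValue_nonneg T n)]
  exact Real.rpow_le_rpow (singularValue_nonneg _ n) (singularValue_mul_mul_le A T B n) hp.le

lemma summable_add_rpow {p : ℝ} (hp : 0 < p) {s t : ℕ → ℝ} (hs0 : ∀ n, 0 ≤ s n)
    (ht0 : ∀ n, 0 ≤ t n) (hs : Summable fun n => s n ^ p) (ht : Summable fun n => t n ^ p) :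
    Summable fun n => (s n + t n) ^ p := by
  refine Summable.of_nonneg_of_le (fun n => Real.rpow_nonneg (add_nonneg (hs0 n) (ht0 n)) p)
    (fun n => ?_) ((hs.add ht).mul_left (2 ^ p))
  have h1 : (max (s n) (t n)) ^ p ≤ s n ^ p + t n ^ p := by
    rcases le_total (s n) (t n) with h | h
    · rw [max_eq_right h]; linarith [Real.rpow_nonneg (hs0 n) p]
    · rw [max_eq_left h]; linarith [Real.rpow_nonneg (ht0 n) p]
  calc (s n + t n) ^ p ≤ (2 * max (s n) (t n)) ^ p :=
        Real.rpow_le_rpow (add_nonneg (hs0 n) (ht0 n))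
          (by linarith [le_max_left (s n) (t n), le_max_right (s n) (t n)]) hp.le
    _ = 2 ^ p * (max (s n) (t n)) ^ p :=
        Real.mul_rpow (by norm_num) ((hs0 n).trans (le_max_left _ _))
    _ ≤ _ := mul_le_mul_of_nonneg_left h1 (by positivity)

lemma HilbertOp.MemSchatten.add {p : ℝ} (hp : 0 < p) {A B : H →L[ℂ] H} (hA : MemSchatten p A)
    (hB : MemSchatten p B) : MemSchatten p (A + B) := by
  have hX : HasSum (fun b : Bool => cond b A B) (A + B) := by
    simpa using hasSum_fintype fun b : Bool => cond b A B
  refine memSchatten_of_hasSum hp (s := fun n => singularValue A n + singularValue B n)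
    (w := fun _ : Bool => 1)
    (fun n => add_nonneg (singularValue_nonneg A n) (singularValue_nonneg B n))
    (summable_add_rpow hp (singularValue_nonneg A) (singularValue_nonneg B) hA hB)
    (fun _ => one_pos) (fun _ _ => Summable.of_finite) ?_ hX
  rintro (_ | _) n
  · simpa using singularValue_nonneg A n
  · simpa using singularValue_nonneg B n

end Series

/-! ### A dyadic partition of unity -/

/-- The continuous cutoff which is `1` on `(-∞, 1]`, `0` on `[2, ∞)` and affine in between. -/
noncomputable def cutoff (x : ℝ) : ℝ := max 0 (min 1 (2 - x))

/-- The `k`-th function of the dyadic partition of unity of `(0, 1]`, supported in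
`[2⁻ᵏ / 2, 2 * 2⁻ᵏ]`. -/
noncomputable def dyadicBump (k : ℕ) (x : ℝ) : ℝ := cutoff (2 ^ k * x) - cutoff (2 ^ (k + 1) * x)

lemma continuous_cutoff : Continuous cutoff := by unfold cutoff; fun_prop

lemma continuous_dyadicBump (k : ℕ) : Continuous (dyadicBump k) :=
  (continuous_cutoff.comp (by fun_prop)).sub (continuous_cutoff.comp (by fun_prop))

lemma cutoff_nonneg (x : ℝ) : 0 ≤ cutoff x := le_max_left _ _

lemma cutoff_le_one (x : ℝ) : cutoff x ≤ 1 := max_le zero_le_one (min_le_left _ _)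

lemma cutoff_of_le_one {x : ℝ} (hx : x ≤ 1) : cutoff x = 1 := by
  rw [cutoff, min_eq_left (by linarith), max_eq_right zero_le_one]

lemma cutoff_of_two_le {x : ℝ} (hx : 2 ≤ x) : cutoff x = 0 :=
  max_eq_left ((min_le_right _ _).trans (by linarith))

lemma abs_dyadicBump_le_one (k : ℕ) (x : ℝ) : |dyadicBump k x| ≤ 1 := by
  rw [dyadicBump, abs_le]
  constructor <;>
    linarith [cutoff_nonneg (2 ^ k * x), cutoff_le_one (2 ^ k * x),
      cutoff_nonneg (2 ^ (k + 1) * x), cutoff_le_one (2 ^ (k + 1) * x)]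

lemma mem_Icc_of_dyadicBump_ne_zero {k : ℕ} {x : ℝ} (hx : dyadicBump k x ≠ 0) :
    x ∈ Set.Icc (2 * (1 / 2) ^ k / 4 : ℝ) (2 * (1 / 2) ^ k) := by
  have h2 : (0 : ℝ) < 2 ^ k := by positivity
  rw [one_div_pow]
  constructor
  · by_contra! h
    rw [mul_one_div, div_div, lt_div_iff₀ (by positivity)] at h
    have h3 : 2 ^ (k + 1) * x ≤ 1 := by rw [pow_succ]; linarith
    have h4 : 2 ^ k * x ≤ 1 := by
      rcases le_total x 0 with h0 | h0
      · nlinarith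
      · nlinarith
    exact hx (by rw [dyadicBump, cutoff_of_le_one h3, cutoff_of_le_one h4, sub_self])
  · by_contra! h
    rw [mul_one_div, div_lt_iff₀ h2] at h
    have h3 : 2 ≤ 2 ^ k * x := by linarith
    have h4 : 2 ≤ 2 ^ (k + 1) * x := by rw [pow_succ]; linarith
    exact hx (by rw [dyadicBump, cutoff_of_two_le h3, cutoff_of_two_le h4, sub_self])

lemma sum_range_dyadicBump (K : ℕ) (x : ℝ) :
    ∑ k ∈ Finset.range K, dyadicBump k x = cutoff x - cutoff (2 ^ K * x) := by
  have := Finset.sum_range_sub' (fun k => cutoff (2 ^ k * x)) K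
  simpa [dyadicBump] using this

/-- The error of the partition of unity after `K` steps, multiplied by `x`, is uniformly small. -/
lemma cutoff_two_pow_mul_mul_le (K : ℕ) {x : ℝ} (hx : 0 ≤ x) :
    cutoff (2 ^ K * x) * x ≤ 2 * (1 / 2) ^ K := by
  rcases le_total 2 (2 ^ K * x) with h | h
  · rw [cutoff_of_two_le h, zero_mul]; positivity
  · rw [one_div_pow, mul_one_div, le_div_iff₀ (by positivity)]
    nlinarith [mul_le_mul_of_nonneg_right (cutoff_le_one (2 ^ K * x)) hx,
      pow_pos (two_pos : (0 : ℝ) < 2) K]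

lemma summable_dyadic_weight {γ : ℝ} (hγ : 0 < γ) {δ : ℝ} (hδ : 0 < δ) :
    Summable fun x : ℕ × ℕ => (((2 * (1 / 2) ^ x.1 : ℝ) ^ γ) * (3 / 4 : ℝ) ^ x.2) ^ δ := by
  have h1 : Summable fun k : ℕ => (((1 / 2 : ℝ) ^ γ) ^ δ) ^ k :=
    summable_geometric_of_lt_one (by positivity)
      (Real.rpow_lt_one (by positivity) (Real.rpow_lt_one (by norm_num) (by norm_num) hγ) hδ)
  have h2 : Summable fun j : ℕ => ((3 / 4 : ℝ) ^ δ) ^ j :=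
    summable_geometric_of_lt_one (by positivity) (Real.rpow_lt_one (by norm_num) (by norm_num) hδ)
  have h3 := (h1.mul_of_nonneg h2 (fun k => by positivity) (fun j => by positivity)).mul_left
    (((2 : ℝ) ^ γ) ^ δ)
  refine h3.congr fun x => ?_
  rw [Real.mul_rpow (by positivity) (by positivity), Real.mul_rpow (by positivity) (by positivity),
    Real.mul_rpow (by positivity) (by positivity), mul_assoc]
  simp only [← Real.rpow_natCast, ← Real.rpow_mul (show (0 : ℝ) ≤ 1 / 2 by norm_num),
    ← Real.rpow_mul (show (0 : ℝ) ≤ 3 / 4 by norm_num)]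
  ring_nf

/-! ### The Sylvester equation -/

/-- The Neumann series of the solution of `U - R U Q = R P`, with remainder. -/
lemma neumann_iterate {A : Type*} [Ring A] {U R P Q : A} (h : U = R * P + R * U * Q) (J : ℕ) :
    U = ∑ j ∈ Finset.range J, R ^ (j + 1) * P * Q ^ j + R ^ J * U * Q ^ J := by
  induction J with
  | zero => simp
  | succ J ih =>
    calc U = ∑ j ∈ Finset.range J, R ^ (j + 1) * P * Q ^ j + R ^ J * U * Q ^ J := ih
      _ = ∑ j ∈ Finset.range J, R ^ (j + 1) * P * Q ^ j +
          R ^ J * (R * P + R * U * Q) * Q ^ J := by rw [← h]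
      _ = _ := by
        rw [Finset.sum_range_succ, mul_add, add_mul, ← add_assoc, pow_succ R J, pow_succ' Q J]
        simp only [mul_assoc]

section Sylvester

variable {H : Type*} [NormedAddCommGroup H] [InnerProductSpace ℂ H] [CompleteSpace H]

lemma eq_zero_of_mul_eq_zero_of_ker_eq_bot {D Z : H →L[ℂ] H} (hD : IsSelfAdjoint D)
    (hker : LinearMap.ker (D : H →ₗ[ℂ] H) = ⊥) (h : Z * D = 0) : Z = 0 := by
  have h1 : D * star Z = 0 := by
    rw [← hD.star_eq, ← star_mul, h, star_zero]
  rw [← star_eq_zero]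
  ext x
  have h2 : D ((star Z) x) = 0 := by
    rw [← mul_apply_eq_comp, h1, zero_apply]
  have h3 : (star Z) x ∈ LinearMap.ker (D : H →ₗ[ℂ] H) := h2
  rw [hker, Submodule.mem_bot] at h3
  rw [h3, zero_apply]

lemma exists_scaled_resolvent {L : H →L[ℂ] H} (hL : 0 ≤ L) {c : ℝ} (hc : 0 < c) :
    ∃ R : H →L[ℂ] H, ‖R‖ ≤ 1 ∧ R * (L + algebraMap ℝ _ c) = algebraMap ℝ _ c := by
  have hcont : ContinuousOn (fun x : ℝ => c / (x + c)) (spectrum ℝ L) := by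
    refine ContinuousOn.div (by fun_prop) (by fun_prop) fun x hx => ?_
    have := spectrum_nonneg_of_nonneg hL hx
    positivity
  refine ⟨cfc (fun x : ℝ => c / (x + c)) L, norm_cfc_le zero_le_one fun x hx => ?_, ?_⟩
  · have := spectrum_nonneg_of_nonneg hL hx
    rw [Real.norm_of_nonneg (by positivity), div_le_one (by positivity)]
    linarith
  · have h1 : L + algebraMap ℝ _ c = cfc (fun x : ℝ => x + c) L := by
      rw [cfc_add_const c (fun x => x) L, cfc_id' ℝ L]
    rw [h1, ← cfc_mul _ _ L, ← cfc_const c L]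
    refine cfc_congr fun x hx => ?_
    have := spectrum_nonneg_of_nonneg hL hx
    exact div_mul_cancel₀ c (by positivity)

/-- Solutions of `L X + X D = M D ^ β`, `β > 1`, inherit membership in `S_p` from `M`. On the
spectral piece of `D` near `c = 2 * 2⁻ᵏ` the equation reads `X E = R M D ^ β E / c + R X E Q` with
`R = c (L + c)⁻¹` and `Q = (c - D) / c`, where `‖E Q ^ j‖ ≤ (3 / 4) ^ j`; its Neumann series has
terms of size `c ^ (β - 1) (3 / 4) ^ j`. -/
theorem memSchatten_of_sylvester {p : ℝ} (hp : 0 < p) {β : ℝ} (hβ : 1 < β) {L D M X : H →L[ℂ] H}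
    (hL : 0 ≤ L) (hD : 0 ≤ D) (hD1 : ‖D‖ ≤ 1) (hker : LinearMap.ker (D : H →ₗ[ℂ] H) = ⊥)
    (hM : MemSchatten p M) (hX : L * X + X * D = M * D ^ β) : MemSchatten p X := by
  have hDsa : IsSelfAdjoint D := hD.isSelfAdjoint
  have hspec : ∀ x ∈ spectrum ℝ D, 0 ≤ x ∧ x ≤ 1 := fun x hx =>
    ⟨spectrum_nonneg_of_nonneg hD hx,
      (le_abs_self x).trans
        ((IsometricContinuousFunctionalCalculus.norm_spectrum_le D hx).trans hD1)⟩
  have hβc : Continuous fun x : ℝ => x ^ β := Real.continuous_rpow_const (by linarith)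
  set c : ℕ → ℝ := fun k => 2 * (1 / 2) ^ k
  have hc0 : ∀ k, 0 < c k := fun k => by positivity
  have hsupp : ∀ k x, dyadicBump k x ≠ 0 → |(c k - x) / c k| ≤ 3 / 4 ∧ 0 ≤ x ∧ x ≤ c k := by
    intro k x hx
    obtain ⟨h1, h2⟩ := mem_Icc_of_dyadicBump_ne_zero hx
    change c k / 4 ≤ x at h1
    change x ≤ c k at h2
    have := hc0 k
    refine ⟨?_, by linarith, h2⟩
    rw [abs_of_nonneg (div_nonneg (by linarith) this.le), div_le_iff₀ this]
    linarith
  choose R hR1 hR using fun k => exists_scaled_resolvent hL (hc0 k)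
  have hRpow : ∀ k j, ‖R k ^ j‖ ≤ 1 := by
    intro k j
    rcases Nat.eq_zero_or_pos j with rfl | hj
    · rw [pow_zero]; exact ContinuousLinearMap.norm_id_le
    · exact (norm_pow_le' _ hj).trans (pow_le_one₀ (norm_nonneg _) (hR1 k))
  set E : ℕ → (H →L[ℂ] H) := fun k => cfc (dyadicBump k) D with hE
  set Q : ℕ → (H →L[ℂ] H) := fun k => cfc (fun x => (c k - x) / c k) D with hQ
  set G : ℕ → ℕ → (H →L[ℂ] H) := fun k j =>
    cfc (fun x => x ^ β / c k * dyadicBump k x * ((c k - x) / c k) ^ j) D with hG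
  have hEc := continuous_dyadicBump
  have hQc : ∀ k, Continuous fun x => (c k - x) / c k := fun k => by fun_prop
  have hEQ : ∀ k j, E k * Q k ^ j = cfc (fun x => dyadicBump k x * ((c k - x) / c k) ^ j) D := by
    intro k j
    rw [cfc_mul (dyadicBump k) (fun x => ((c k - x) / c k) ^ j) D (hEc k).continuousOn
      ((hQc k).pow j).continuousOn, cfc_pow _ j D (hQc k).continuousOn]
  have hGc : ∀ k, Continuous fun x : ℝ => x ^ β / c k := fun k => hβc.div_const _
  have hGmul : ∀ k j, G k j = G k 0 * Q k ^ j := by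
    intro k j
    simp only [hG, hQ, pow_zero, mul_one]
    rw [cfc_mul (fun x => x ^ β / c k * dyadicBump k x) (fun x => ((c k - x) / c k) ^ j) D
      ((hGc k).mul (hEc k)).continuousOn ((hQc k).pow j).continuousOn,
      cfc_pow _ j D (hQc k).continuousOn]
  have hG0 : ∀ k, algebraMap ℝ _ (c k) * G k 0 = D ^ β * E k := by
    intro k
    simp only [hG, hE, pow_zero, mul_one]
    rw [CFC.rpow_eq_cfc_real hD, ← cfc_const (c k) D,
      ← cfc_mul _ (fun x => x ^ β / c k * dyadicBump k x) D continuousOn_const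
        ((hGc k).mul (hEc k)).continuousOn,
      ← cfc_mul _ _ D hβc.continuousOn (hEc k).continuousOn]
    refine cfc_congr fun x _ => ?_
    change c k * (x ^ β / c k * dyadicBump k x) = x ^ β * dyadicBump k x
    rw [← mul_assoc, mul_div_cancel₀ _ (hc0 k).ne']
  have hGnorm : ∀ k j, ‖G k j‖ ≤ c k ^ (β - 1) * (3 / 4) ^ j := by
    intro k j
    refine norm_cfc_le (by have := hc0 k; positivity) fun x _ => ?_
    by_cases hx : dyadicBump k x = 0
    · rw [hx, mul_zero, zero_mul, norm_zero]
      have := hc0 k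
      positivity
    · obtain ⟨h1, h2, h3⟩ := hsupp k x hx
      have h4 : x ^ β / c k ≤ c k ^ (β - 1) := by
        rw [Real.rpow_sub_one (hc0 k).ne']
        exact div_le_div_of_nonneg_right (Real.rpow_le_rpow h2 h3 (by linarith)) (hc0 k).le
      rw [norm_mul, norm_mul, norm_pow, Real.norm_eq_abs, Real.norm_eq_abs, Real.norm_eq_abs,
        abs_of_nonneg (div_nonneg (Real.rpow_nonneg h2 _) (hc0 k).le)]
      refine mul_le_mul ?_ (pow_le_pow_left₀ (abs_nonneg _) h1 j) (by positivity)
        (by have := hc0 k; positivity)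
      calc x ^ β / c k * |dyadicBump k x| ≤ x ^ β / c k * 1 :=
            mul_le_mul_of_nonneg_left (abs_dyadicBump_le_one k x)
              (div_nonneg (Real.rpow_nonneg h2 _) (hc0 k).le)
        _ ≤ c k ^ (β - 1) := by rwa [mul_one]
  have hEQnorm : ∀ k j, ‖E k * Q k ^ j‖ ≤ (3 / 4) ^ j := by
    intro k j
    rw [hEQ]
    refine norm_cfc_le (by positivity) fun x _ => ?_
    by_cases hx : dyadicBump k x = 0
    · rw [hx, zero_mul, norm_zero]
      positivity
    · rw [norm_mul, norm_pow, Real.norm_eq_abs, Real.norm_eq_abs, ← one_mul ((3 / 4 : ℝ) ^ j)]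
      exact mul_le_mul (abs_dyadicBump_le_one k x)
        (pow_le_pow_left₀ (abs_nonneg _) (hsupp k x hx).1 j) (by positivity) zero_le_one
  -- The equation on the `k`-th spectral piece, solved for `X E`.
  have hfix : ∀ k, X * E k = R k * (M * G k 0) + R k * (X * E k) * Q k := by
    intro k
    have hcq : algebraMap ℝ (H →L[ℂ] H) (c k) * Q k = algebraMap ℝ _ (c k) - D := by
      simp only [hQ]
      conv_rhs => rw [← cfc_id' ℝ D]
      rw [← cfc_const (c k) D, ← cfc_mul _ _ D continuousOn_const (hQc k).continuousOn,
        ← cfc_sub (fun _ => c k) (fun x => x) D continuousOn_const continuousOn_id]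
      exact cfc_congr fun x _ => mul_div_cancel₀ _ (hc0 k).ne'
    have hcomm : E k * D = D * E k := (Commute.cfc_real (Commute.refl D) (dyadicBump k)).eq
    have hcA : ∀ T : H →L[ℂ] H, T * algebraMap ℝ _ (c k) = algebraMap ℝ _ (c k) * T := fun T =>
      (Algebra.commutes _ _).symm
    have hinj : ∀ S T : H →L[ℂ] H,
        algebraMap ℝ (H →L[ℂ] H) (c k) * S = algebraMap ℝ _ (c k) * T → S = T := by
      intro S T h
      rw [← Algebra.smul_def, ← Algebra.smul_def] at h
      exact smul_right_injective _ (hc0 k).ne' h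
    apply hinj
    calc algebraMap ℝ _ (c k) * (X * E k)
        = R k * (L + algebraMap ℝ _ (c k)) * (X * E k) := by rw [hR k]
      _ = R k * ((L * X + X * D) * E k + X * E k * (algebraMap ℝ _ (c k) - D)) := by
          rw [mul_sub, hcA (X * E k), add_mul, mul_assoc X D, ← hcomm]
          noncomm_ring
      _ = R k * (M * (algebraMap ℝ _ (c k) * G k 0) +
            X * E k * (algebraMap ℝ _ (c k) * Q k)) := by rw [hX, hcq, hG0, mul_assoc M]
      _ = algebraMap ℝ _ (c k) * (R k * (M * G k 0) + R k * (X * E k) * Q k) := by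
          rw [← mul_assoc M, hcA M, ← mul_assoc (X * E k), hcA (X * E k),
            mul_assoc (algebraMap _ _ _), mul_assoc (algebraMap _ _ _), ← mul_add, ← mul_assoc (R k), hcA (R k), mul_assoc,
            mul_add, mul_assoc (R k)]
  set Y : ℕ × ℕ → (H →L[ℂ] H) := fun x => R x.1 ^ (x.2 + 1) * M * G x.1 x.2 with hYdef
  set w : ℕ × ℕ → ℝ := fun x => c x.1 ^ (β - 1) * (3 / 4) ^ x.2
  have hw0 : ∀ x, 0 < w x := fun x => by have := hc0 x.1; positivity
  have hws : ∀ δ : ℝ, 0 < δ → Summable fun x => w x ^ δ := fun δ hδ =>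
    summable_dyadic_weight (by linarith) hδ
  have hYnorm : ∀ x, ‖Y x‖ ≤ w x * ‖M‖ := by
    intro x
    calc ‖Y x‖ ≤ ‖R x.1 ^ (x.2 + 1)‖ * ‖M‖ * ‖G x.1 x.2‖ :=
          (norm_mul_le _ _).trans (mul_le_mul_of_nonneg_right (norm_mul_le _ _) (norm_nonneg _))
      _ ≤ 1 * ‖M‖ * w x := by
          gcongr
          · exact hRpow _ _
          · exact hGnorm _ _
      _ = w x * ‖M‖ := by ring
  have hYsum : Summable Y :=
    Summable.of_norm_bounded (((hws 1 one_pos).congr fun x => Real.rpow_one _).mul_right _) hYnorm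
  have hfiber : ∀ k, HasSum (fun j => Y (k, j)) (X * E k) := by
    intro k
    rw [(hYsum.prod_factor k).hasSum_iff_tendsto_nat]
    have hrem : Filter.Tendsto (fun J => R k ^ J * (X * E k) * Q k ^ J) Filter.atTop (nhds 0) := by
      refine squeeze_zero_norm (a := fun J => ‖X‖ * (3 / 4 : ℝ) ^ J) (fun J => ?_) ?_
      · calc ‖R k ^ J * (X * E k) * Q k ^ J‖ = ‖R k ^ J * X * (E k * Q k ^ J)‖ := by
              simp only [mul_assoc]
          _ ≤ ‖R k ^ J‖ * ‖X‖ * ‖E k * Q k ^ J‖ :=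
              (norm_mul_le _ _).trans
                (mul_le_mul_of_nonneg_right (norm_mul_le _ _) (norm_nonneg _))
          _ ≤ 1 * ‖X‖ * (3 / 4) ^ J := by
              gcongr
              · exact hRpow _ _
              · exact hEQnorm _ _
          _ = ‖X‖ * (3 / 4) ^ J := by rw [one_mul]
      · simpa using (tendsto_pow_atTop_nhds_zero_of_lt_one (show (0 : ℝ) ≤ 3 / 4 by norm_num)
          (by norm_num)).const_mul ‖X‖
    have h1 : ∀ J, ∑ j ∈ Finset.range J, Y (k, j) =
        X * E k - R k ^ J * (X * E k) * Q k ^ J := by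
      intro J
      rw [eq_sub_iff_add_eq]
      conv_rhs => rw [neumann_iterate (hfix k) J]
      congr 1
      refine Finset.sum_congr rfl fun j _ => ?_
      simp only [hYdef]
      rw [hGmul k j]
      simp only [mul_assoc]
    simp_rw [h1]
    simpa using hrem.const_sub (X * E k)
  -- The pieces `X E` add up to `X`: they do after multiplication by `D`, whose kernel is trivial.
  have hXsum : HasSum Y X := by
    have hZ : HasSum (fun k => X * E k) (∑' x, Y x) := hYsum.hasSum.prod_fiberwise hfiber
    have hcut : ∀ K : ℕ, Continuous fun x : ℝ => cutoff (2 ^ K * x) := fun K =>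
      continuous_cutoff.comp (by fun_prop)
    have hpart : ∀ K, ∑ k ∈ Finset.range K, X * E k * D =
        X * D - X * cfc (fun x => cutoff (2 ^ K * x) * x) D := by
      intro K
      have h1 : (∑ k ∈ Finset.range K, E k) * D =
          D - cfc (fun x => cutoff (2 ^ K * x) * x) D := by
        have hs : Continuous (∑ k ∈ Finset.range K, dyadicBump k) := by
          rw [Finset.sum_fn]
          exact continuous_finsetSum _ fun k _ => hEc k
        have hcK : Continuous fun x : ℝ => cutoff (2 ^ K * x) * x := (hcut K).mul continuous_id
        simp only [hE]
        rw [← cfc_sum (fun k => dyadicBump k) D (Finset.range K) fun k _ => (hEc k).continuousOn]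
        calc cfc (∑ k ∈ Finset.range K, dyadicBump k) D * D
            = cfc (∑ k ∈ Finset.range K, dyadicBump k) D * cfc (fun x : ℝ => x) D := by
              rw [cfc_id' ℝ D]
          _ = cfc (fun x => x - cutoff (2 ^ K * x) * x) D := by
              rw [← cfc_mul _ (fun x => x) D hs.continuousOn continuousOn_id]
              refine cfc_congr fun x hx => ?_
              change (∑ k ∈ Finset.range K, dyadicBump k) x * x = x - cutoff (2 ^ K * x) * x
              rw [Finset.sum_apply, sum_range_dyadicBump, cutoff_of_le_one (hspec x hx).2]
              ring
          _ = D - cfc (fun x => cutoff (2 ^ K * x) * x) D := by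
              rw [cfc_sub (fun x => x) _ D continuousOn_id hcK.continuousOn, cfc_id' ℝ D]
      rw [← Finset.sum_mul, ← Finset.mul_sum, mul_assoc, h1, mul_sub]
    have hlim : Filter.Tendsto (fun K : ℕ => X * cfc (fun x => cutoff (2 ^ K * x) * x) D)
        Filter.atTop (nhds 0) := by
      refine squeeze_zero_norm (a := fun K => ‖X‖ * (2 * (1 / 2 : ℝ) ^ K)) (fun K => ?_) ?_
      · refine (norm_mul_le _ _).trans (mul_le_mul_of_nonneg_left ?_ (norm_nonneg _))
        refine norm_cfc_le (by positivity) fun x hx => ?_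
        rw [Real.norm_of_nonneg (mul_nonneg (cutoff_nonneg _) (hspec x hx).1)]
        exact cutoff_two_pow_mul_mul_le K (hspec x hx).1
      · simpa using ((tendsto_pow_atTop_nhds_zero_of_lt_one (show (0 : ℝ) ≤ 1 / 2 by norm_num)
          (by norm_num)).const_mul 2).const_mul ‖X‖
    have hZD := (hZ.mul_right D).tendsto_sum_nat
    simp_rw [hpart] at hZD
    have hXD := hlim.const_sub (X * D)
    rw [sub_zero] at hXD
    have h2 : (∑' x, Y x) - X = 0 := eq_zero_of_mul_eq_zero_of_ker_eq_bot hDsa hker (by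
      rw [sub_mul, tendsto_nhds_unique hZD hXD, sub_self])
    rw [← sub_eq_zero.1 h2]
    exact hYsum.hasSum
  refine memSchatten_of_hasSum hp (singularValue_nonneg M) hM hw0 hws (fun x n => ?_) hXsum
  refine (singularValue_mul_mul_le _ _ _ n).trans
    (mul_le_mul_of_nonneg_right ?_ (singularValue_nonneg M n))
  calc ‖R x.1 ^ (x.2 + 1)‖ * ‖G x.1 x.2‖ ≤ 1 * w x :=
        mul_le_mul (hRpow _ _) (hGnorm _ _) (norm_nonneg _) zero_le_one
    _ = w x := one_mul _

end Sylvester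

/-! ### Intertwining relations and the functional calculus -/

section Intertwining

variable {H : Type*} [NormedAddCommGroup H] [InnerProductSpace ℂ H] [CompleteSpace H]

/-- An operator intertwining two self-adjoint operators intertwines continuous functions of them:
this holds for polynomials, and passes to uniform limits on the union of the two spectra. -/
lemma semiconjBy_cfc_real {b a a' : H →L[ℂ] H} (ha : IsSelfAdjoint a) (ha' : IsSelfAdjoint a')
    (h : SemiconjBy b a a') {f : ℝ → ℝ} (hf : Continuous f) :
    SemiconjBy b (cfc f a) (cfc f a') := by
  set s : Set ℝ := spectrum ℝ a ∪ spectrum ℝ a'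
  have hsa : spectrum ℝ a ⊆ s := Set.subset_union_left
  have hsa' : spectrum ℝ a' ⊆ s := Set.subset_union_right
  have : CompactSpace s := isCompact_iff_compactSpace.1
    ((ContinuousFunctionalCalculus.isCompact_spectrum a).union
      (ContinuousFunctionalCalculus.isCompact_spectrum a'))
  have key : ∀ g : C(s, ℝ), SemiconjBy b (cfcHomSuperset ha hsa g) (cfcHomSuperset ha' hsa' g) := by
    intro g
    induction g using ContinuousMap.induction_on_of_compact with
    | const r =>
      have h1 : ContinuousMap.const s r = algebraMap ℝ C(s, ℝ) r := rfl
      rw [h1, AlgHomClass.commutes, AlgHomClass.commutes]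
      exact (Algebra.commutes r b).symm
    | id => rwa [cfcHomSuperset_id, cfcHomSuperset_id]
    | star_id => rwa [star_trivial, cfcHomSuperset_id, cfcHomSuperset_id]
    | add f g hf hg => rw [map_add, map_add]; exact hf.add_right hg
    | mul f g hf hg => rw [map_mul, map_mul]; exact hf.mul_right hg
    | frequently f hf =>
      have hcl : IsClosed {g : C(s, ℝ) | b * cfcHomSuperset ha hsa g =
          cfcHomSuperset ha' hsa' g * b} :=
        isClosed_eq (continuous_const.mul (cfcHomSuperset_continuous ha hsa))
          ((cfcHomSuperset_continuous ha' hsa').mul continuous_const)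
      exact hcl.closure_subset (mem_closure_iff_frequently.2 hf)
  have h1 := key ⟨fun x => f x, hf.comp continuous_subtype_val⟩
  rw [cfcHomSuperset_apply, cfcHomSuperset_apply] at h1
  rw [cfc_apply f a ha hf.continuousOn, cfc_apply f a' ha' hf.continuousOn]
  exact h1

lemma semiconjBy_rpow {b a a' : H →L[ℂ] H} (ha : 0 ≤ a) (ha' : 0 ≤ a') (h : SemiconjBy b a a')
    {s : ℝ} (hs : 0 ≤ s) : SemiconjBy b (a ^ s) (a' ^ s) := by
  rw [CFC.rpow_eq_cfc_real ha, CFC.rpow_eq_cfc_real ha']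
  exact semiconjBy_cfc_real ha.isSelfAdjoint ha'.isSelfAdjoint h (Real.continuous_rpow_const hs)

end Intertwining

/-! ### Defect operators -/

section Defect

open ContinuousLinearMap

variable {H : Type*} [NormedAddCommGroup H] [InnerProductSpace ℂ H] [CompleteSpace H]

lemma one_sub_adjoint_mul_self_nonneg {T : H →L[ℂ] H} (hT : ‖T‖ ≤ 1) : 0 ≤ 1 - adjoint T * T := by
  rw [sub_nonneg, ← star_eq_adjoint,
    ← CStarAlgebra.norm_le_one_iff_of_nonneg _ (star_mul_self_nonneg T),
    CStarRing.norm_star_mul_self]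
  exact mul_le_one₀ hT (norm_nonneg _) hT

lemma defect_nonneg (T : H →L[ℂ] H) : 0 ≤ defect T := CFC.sqrt_nonneg _

lemma defect_mul_self {T : H →L[ℂ] H} (hT : ‖T‖ ≤ 1) :
    defect T * defect T = 1 - adjoint T * T :=
  CFC.sqrt_mul_sqrt_self _ (one_sub_adjoint_mul_self_nonneg hT)

lemma norm_defect_le_one {T : H →L[ℂ] H} (hT : ‖T‖ ≤ 1) : ‖defect T‖ ≤ 1 := by
  have h1 : ‖defect T * defect T‖ ≤ 1 := by
    rw [defect_mul_self hT, CStarAlgebra.norm_le_one_iff_of_nonneg _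
      (one_sub_adjoint_mul_self_nonneg hT), sub_le_self_iff, ← star_eq_adjoint]
    exact star_mul_self_nonneg T
  have h2 : ‖defect T‖ * ‖defect T‖ ≤ 1 := by
    rwa [← CStarRing.norm_star_mul_self, (defect_nonneg T).isSelfAdjoint.star_eq]
  nlinarith [norm_nonneg (defect T)]

lemma semiconjBy_defect {T : H →L[ℂ] H} (hT : ‖T‖ ≤ 1) :
    SemiconjBy T (defect T) (defect (adjoint T)) := by
  have hT' : ‖adjoint T‖ ≤ 1 := by rwa [LinearIsometryEquiv.norm_map]
  have h0 := one_sub_adjoint_mul_self_nonneg hT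
  have h0' := one_sub_adjoint_mul_self_nonneg hT'
  have h1 : SemiconjBy T (1 - adjoint T * T) (1 - adjoint (adjoint T) * adjoint T) := by
    rw [SemiconjBy, adjoint_adjoint]
    noncomm_ring
  have h2 := semiconjBy_rpow h0 h0' h1 (one_half_pos (α := ℝ)).le
  rwa [← CFC.sqrt_eq_rpow, ← CFC.sqrt_eq_rpow] at h2

lemma semiconjBy_defect_rpow {T : H →L[ℂ] H} (hT : ‖T‖ ≤ 1) {s : ℝ} (hs : 0 ≤ s) :
    SemiconjBy T (defect T ^ s) (defect (adjoint T) ^ s) :=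
  semiconjBy_rpow (defect_nonneg T) (defect_nonneg (adjoint T)) (semiconjBy_defect hT) hs

lemma ker_defect_adjoint {T : H →L[ℂ] H} (hT : ‖T‖ ≤ 1)
    (hker : LinearMap.ker (defect T : H →ₗ[ℂ] H) = ⊥) :
    LinearMap.ker (defect (adjoint T) : H →ₗ[ℂ] H) = ⊥ := by
  have hT' : ‖adjoint T‖ ≤ 1 := by rwa [LinearIsometryEquiv.norm_map]
  rw [LinearMap.ker_eq_bot'] at hker ⊢
  intro x hx
  have hx : defect (adjoint T) x = 0 := hx
  have h1 : x - T (adjoint T x) = 0 := by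
    have h2 := congrArg (fun S : H →L[ℂ] H => S x) (defect_mul_self hT')
    simpa [hx, adjoint_adjoint] using h2.symm
  have h3 : adjoint T x = 0 := by
    apply hker
    have h4 := congrArg (fun S : H →L[ℂ] H => S x) (semiconjBy_defect hT').eq
    rw [adjoint_adjoint] at h4
    simpa [hx] using h4.symm
  rwa [h3, map_zero, sub_zero] at h1

lemma ker_rpow_eq_bot {D : H →L[ℂ] H} (hD : 0 ≤ D) (hker : LinearMap.ker (D : H →ₗ[ℂ] H) = ⊥)
    {s : ℝ} (hs : 0 ≤ s) (hs2 : s ≤ 2) : LinearMap.ker ((D ^ s : H →L[ℂ] H) : H →ₗ[ℂ] H) = ⊥ := by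
  have hmul : D ^ (2 - s) * D ^ s = D * D := by
    conv_rhs => rw [← cfc_id' ℝ D hD.isSelfAdjoint]
    rw [CFC.rpow_eq_cfc_real hD, CFC.rpow_eq_cfc_real hD,
      ← cfc_mul _ _ D (Real.continuous_rpow_const (by linarith)).continuousOn
        (Real.continuous_rpow_const hs).continuousOn,
      ← cfc_mul (fun x => x) (fun x => x) D continuousOn_id continuousOn_id]
    refine cfc_congr fun x hx => ?_
    change x ^ (2 - s) * x ^ s = x * x
    rw [← Real.rpow_add_of_nonneg (spectrum_nonneg_of_nonneg hD hx) (by linarith) hs,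
      sub_add_cancel, Real.rpow_two, sq]
  rw [LinearMap.ker_eq_bot'] at hker ⊢
  intro x hx
  have hx : (D ^ s) x = 0 := hx
  have h1 := congrArg (fun S : H →L[ℂ] H => S x) hmul
  simp only [mul_apply_eq_comp, hx, map_zero] at h1
  exact hker _ (hker _ h1.symm)

/-- On the domain `Ran D ^ s`, the hypothesis `B D ^ (-s) ∈ S_p` is the factorization
`B = K D ^ s` with `K ∈ S_p`. -/
lemma exists_eq_mul_rpow_of_pmapMemSchatten {p s : ℝ} {B D : H →L[ℂ] H}
    (hker : LinearMap.ker ((D ^ s : H →L[ℂ] H) : H →ₗ[ℂ] H) = ⊥)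
    (h : PMapMemSchatten p (LinearMap.compPMap (B : H →ₗ[ℂ] H) (negPow D s))) :
    ∃ K : H →L[ℂ] H, MemSchatten p K ∧ B = K * D ^ s := by
  obtain ⟨K, hle, hK⟩ := h
  refine ⟨K, hK, ?_⟩
  ext x
  set f : H →ₗ.[ℂ] H := LinearMap.toPMap ((D ^ s : H →L[ℂ] H) : H →ₗ[ℂ] H) ⊤
  have hfker : f.toFun.ker = ⊥ := by
    rw [LinearMap.ker_eq_bot'] at hker ⊢
    intro y hy
    exact Subtype.ext (hker y hy)
  have hmem : (D ^ s) x ∈ (negPow D s).domain := by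
    rw [negPow, LinearPMap.inverse_domain]
    exact ⟨⟨x, trivial⟩, rfl⟩
  have hinv : negPow D s ⟨(D ^ s) x, hmem⟩ = x :=
    LinearPMap.inverse_apply_eq (f := f) hfker (x := ⟨x, trivial⟩) rfl
  have h1 := hle.2 (x := ⟨(D ^ s) x, hmem⟩) (y := ⟨(D ^ s) x, trivial⟩) rfl
  calc B x = B (negPow D s ⟨(D ^ s) x, hmem⟩) := by rw [hinv]
    _ = K ((D ^ s) x) := h1

/-- The difference `X` of the defect operators solves `D_{T₁} X + X D_{T₀} = M D_{T₀} ^ β` with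
`M = -(T₁* K + K' T₀)`, where `T₁ - T₀ = K D_{T₀} ^ β` and `T₁* - T₀* = K' D_{T₀*} ^ β`. -/
theorem memSchatten_defect_sub_defect {p : ℝ} (hp : 0 < p) {β : ℝ} (hβ : 1 < β)
    {T₀ T₁ K K' : H →L[ℂ] H} (hT₀ : ‖T₀‖ ≤ 1) (hT₁ : ‖T₁‖ ≤ 1)
    (hker : LinearMap.ker (defect T₀ : H →ₗ[ℂ] H) = ⊥)
    (hK : MemSchatten p K) (hK' : MemSchatten p K') (h : T₁ - T₀ = K * defect T₀ ^ β)
    (h' : adjoint T₁ - adjoint T₀ = K' * defect (adjoint T₀) ^ β) :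
    MemSchatten p (defect T₁ - defect T₀) := by
  have hM : MemSchatten p (-adjoint T₁ * K * 1 + -1 * K' * T₀) :=
    (hK.mul_mul hp _ _).add hp (hK'.mul_mul hp _ _)
  refine memSchatten_of_sylvester hp hβ (defect_nonneg T₁) (defect_nonneg T₀)
    (norm_defect_le_one hT₀) hker hM ?_
  calc defect T₁ * (defect T₁ - defect T₀) + (defect T₁ - defect T₀) * defect T₀
      = defect T₁ * defect T₁ - defect T₀ * defect T₀ := by noncomm_ring
    _ = -adjoint T₁ * (T₁ - T₀) - (adjoint T₁ - adjoint T₀) * T₀ := by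
      rw [defect_mul_self hT₀, defect_mul_self hT₁]; noncomm_ring
    _ = -adjoint T₁ * (K * defect T₀ ^ β) - K' * (T₀ * defect T₀ ^ β) := by
      rw [h, h', (semiconjBy_defect_rpow hT₀ (by linarith)).eq, mul_assoc K']
    _ = _ := by noncomm_ring

end Defect

theorem lemma2p1 {H : Type*} [NormedAddCommGroup H] [InnerProductSpace ℂ H] [CompleteSpace H]
    (p : ℝ) (hp : 0 < p) (T₀ T₁ : H →L[ℂ] H) (hT₀ : ‖T₀‖ ≤ 1) (hT₁ : ‖T₁‖ ≤ 1)
    (hker : LinearMap.ker (HilbertOp.defect T₀ : H →ₗ[ℂ] H) = ⊥)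
    (α : ℝ) (hα : 1 / 2 < α) (hα' : α ≤ 1)
    (h : HilbertOp.PMapMemSchatten p
      (LinearMap.compPMap ((T₁ - T₀ : H →L[ℂ] H) : H →ₗ[ℂ] H)
        (HilbertOp.negPow (HilbertOp.defect T₀) (2 * α))))
    (h' : HilbertOp.PMapMemSchatten p
      (LinearMap.compPMap
        ((ContinuousLinearMap.adjoint T₁ - ContinuousLinearMap.adjoint T₀ : H →L[ℂ] H) :
          H →ₗ[ℂ] H)
        (HilbertOp.negPow (HilbertOp.defect (ContinuousLinearMap.adjoint T₀)) (2 * α)))) :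
    HilbertOp.MemSchatten p (HilbertOp.defect T₁ - HilbertOp.defect T₀) ∧
      HilbertOp.MemSchatten p (HilbertOp.defect (ContinuousLinearMap.adjoint T₁) -
        HilbertOp.defect (ContinuousLinearMap.adjoint T₀)) := by
  have hβ : 1 < 2 * α := by linarith
  have hβ2 : 2 * α ≤ 2 := by linarith
  have hT₀' : ‖ContinuousLinearMap.adjoint T₀‖ ≤ 1 := by rwa [LinearIsometryEquiv.norm_map]
  have hT₁' : ‖ContinuousLinearMap.adjoint T₁‖ ≤ 1 := by rwa [LinearIsometryEquiv.norm_map]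
  have hker' := ker_defect_adjoint hT₀ hker
  obtain ⟨K, hK, hKeq⟩ := exists_eq_mul_rpow_of_pmapMemSchatten
    (ker_rpow_eq_bot (defect_nonneg T₀) hker (by linarith) hβ2) h
  obtain ⟨K', hK', hKeq'⟩ := exists_eq_mul_rpow_of_pmapMemSchatten
    (ker_rpow_eq_bot (defect_nonneg _) hker' (by linarith) hβ2) h'
  refine ⟨memSchatten_defect_sub_defect hp hβ hT₀ hT₁ hker hK hK' hKeq hKeq',
    memSchatten_defect_sub_defect hp hβ hT₀' hT₁' hker' hK' hK hKeq' ?_⟩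
  simpa only [ContinuousLinearMap.adjoint_adjoint] using hKeq
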